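/- Let $F$ be an algebraic closure of a finite field, let $q$ be a prime power, let $n\ge 0$ be an integer, and let $G=\mathrm{GL}_n(\mathbb{F}_q)$. Let $U\le G$ be the subgroup of upper triangular matrices with all diagonal entries equal to $1$. Let $\psi:\mathbb{F}_q\to F^\times$ be a nontrivial character of the additive group of $\mathbb{F}_q$, and let $\eta_\psi:U\to F^\times$ be the character $$\eta_\psi\big((x_{ij})\big)=\psi\Big(\sum_{i=1}^{n-1}x_{i,i+1}\Big),$$ also regarded as a one-dimensional representation of $U$ over $F$. Then $(G,U,\eta_\psi)$ is a multiplicity-free triple over $F$; that is, for every irreducible representation $\pi$ of $G$ over $F$, $$\dim_F\operatorname{Hom}_G\big(\pi,\operatorname{Ind}_U^G(\eta_\psi)\big)\le 1,$$ where $\operatorname{Ind}_U^G(\eta_\psi)=F[G]\otimes_{F[U]}\eta_\psi$. In other words, $(G,U)$ is an $\eta_\psi$-twisted Gelfand pair over $F$: for every irreducible representation $\pi$ of $G$ over $F$, $$\dim_F\operatorname{Hom}_U\big(\operatorname{Res}^G_U\pi,\eta_\psi\big)\le 1.$$ -/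

import Mathlib

universe w

namespace MultFree

section General

variable {F : Type*} [Field F] {G : Type*} [Group G]

/-- A representation `ρ` of `G` over `F` is multiplicity-free if
`dim_F Hom_G(π, ρ) ≤ 1` for every irreducible representation `π` of `G` over `F`.
The dimension is a cardinal, so the bound includes finite-dimensionality. -/
def IsMultiplicityFree {W : Type*} [AddCommGroup W] [Module F W]
    (ρ : Representation F G W) : Prop :=
  ∀ (V : Type w) [AddCommGroup V] [Module F V] (π : Representation F G V),
    π.IsIrreducible → Module.rank F (Representation.IntertwiningMap π ρ) ≤ 1

/-- `(G, H, η)` is a multiplicity-free triple over `F`: the induced representation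
`Ind_H^G η = F[G] ⊗_{F[H]} η` is multiplicity-free. -/
def IsMultiplicityFreeTriple (H : Subgroup G) {W : Type*} [AddCommGroup W] [Module F W]
    (η : Representation F H W) : Prop :=
  IsMultiplicityFree.{w} (Representation.ind H.subtype η)

/-- A multiplicative character `χ : H → Fˣ`, given as a monoid homomorphism to `F`, regarded as
a one-dimensional representation on `F`. -/
def characterRep {H : Type*} [Group H] (χ : H →* F) : Representation F H F :=
  (Algebra.lmul F F : F →* Module.End F F).comp χ

/-- `(G, H)` is a `χ`-twisted Gelfand pair over `F`: every irreducible representation `π` of `G`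
over `F` satisfies `dim_F Hom_H(Res π, χ) ≤ 1`. -/
def IsTwistedGelfandPair (H : Subgroup G) (χ : H →* F) : Prop :=
  ∀ (V : Type w) [AddCommGroup V] [Module F V] (π : Representation F G V),
    π.IsIrreducible →
      Module.rank F
        (Representation.IntertwiningMap (π.comp H.subtype) (characterRep χ)) ≤ 1

end General

section LinearGroup

variable (n : ℕ) (K : Type*) [Field K]

/-- The upper unitriangular subgroup `U` of `GL_n(K)`: ones on the diagonal and zeros
below it. -/
def unipotent : Subgroup (GL (Fin n) K) where
  carrier := {g | (∀ i, g i i = 1) ∧ ∀ i j, j < i → g i j = 0}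
  one_mem' := by
    refine ⟨fun i => by simp, fun i j h => ?_⟩
    simp [Matrix.one_apply_ne h.ne']
  mul_mem' := by
    rintro a b ⟨ha, ha'⟩ ⟨hb, hb'⟩
    refine ⟨fun i => ?_, fun i j h => ?_⟩
    · rw [Units.val_mul, Matrix.mul_apply, Finset.sum_eq_single i]
      · rw [ha, hb, one_mul]
      · intro k _ hk
        rcases lt_or_gt_of_ne hk with hk | hk
        · rw [ha' i k hk, zero_mul]
        · rw [hb' k i hk, mul_zero]
      · simp
    · rw [Units.val_mul, Matrix.mul_apply]
      refine Finset.sum_eq_zero fun k _ => ?_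
      rcases lt_or_ge k i with hk | hk
      · rw [ha' i k hk, zero_mul]
      · rw [hb' k j (h.trans_le hk), mul_zero]
  inv_mem' := by
    rintro a ⟨ha, ha'⟩
    have hT : Matrix.BlockTriangular (a : Matrix (Fin n) (Fin n) K) id := fun i j h => ha' i j h
    have hTi : ∀ i j, j < i → (a⁻¹ : GL (Fin n) K) i j = 0 := by
      intro i j h
      have := a.invertible
      rw [Matrix.coe_units_inv]
      exact Matrix.blockTriangular_inv_of_blockTriangular hT h
    refine ⟨fun i => ?_, hTi⟩
    have h1 : (a * a⁻¹ : GL (Fin n) K) i i = 1 := by simp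
    rw [Units.val_mul, Matrix.mul_apply, Finset.sum_eq_single i] at h1
    · rwa [ha, one_mul] at h1
    · intro k _ hk
      rcases lt_or_gt_of_ne hk with hk | hk
      · rw [ha' i k hk, zero_mul]
      · rw [hTi k i hk, mul_zero]
    · simp

variable {n K}

/-- The sum `x_{1,2} + x_{2,3} + ⋯ + x_{n-1,n}` of the superdiagonal entries. -/
def superdiagonalSum (x : Matrix (Fin n) (Fin n) K) : K :=
  ∑ i : Fin n, if h : (i : ℕ) + 1 < n then x i ⟨i + 1, h⟩ else 0

theorem superdiagonalSum_one : superdiagonalSum (1 : Matrix (Fin n) (Fin n) K) = 0 := by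
  refine Finset.sum_eq_zero fun i _ => ?_
  split_ifs with h
  · exact Matrix.one_apply_ne (by simp [Fin.ext_iff])
  · rfl

theorem superdiagonalSum_mul (a b : unipotent n K) :
    superdiagonalSum ((a * b : unipotent n K) : GL (Fin n) K).val =
      superdiagonalSum (a : GL (Fin n) K).val + superdiagonalSum (b : GL (Fin n) K).val := by
  obtain ⟨a, ha, ha'⟩ := a
  obtain ⟨b, hb, hb'⟩ := b
  simp only [superdiagonalSum, Subgroup.coe_mul, ← Finset.sum_add_distrib]
  refine Finset.sum_congr rfl fun i _ => ?_
  split_ifs with h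
  · have hne : i ≠ ⟨i + 1, h⟩ := by simp [Fin.ext_iff]
    rw [Units.val_mul, Matrix.mul_apply,
      Finset.sum_eq_add i ⟨i + 1, h⟩ hne ?_ (by simp) (by simp)]
    · rw [ha, hb, one_mul, mul_one, add_comm]
    · rintro k - ⟨hk1, hk2⟩
      rcases lt_or_gt_of_ne hk1 with hk | hk
      · rw [ha' i k hk, zero_mul]
      · have : (⟨i + 1, h⟩ : Fin n) < k := by
          rw [Fin.lt_def] at hk ⊢
          have := Fin.val_ne_of_ne hk2
          simp only at this ⊢
          omega
        rw [hb' k _ this, mul_zero]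
  · simp

/-- The character `η_ψ((x_{ij})) = ψ(x_{1,2} + ⋯ + x_{n-1,n})` of the unipotent subgroup. -/
def genericCharacter {F : Type*} [Field F] (ψ : AddChar K F) : unipotent n K →* F where
  toFun u := ψ (superdiagonalSum (u : GL (Fin n) K).val)
  map_one' := by
    rw [Subgroup.coe_one, Units.val_one, superdiagonalSum_one, AddChar.map_zero_eq_one]
  map_mul' a b := by rw [superdiagonalSum_mul, AddChar.map_add_eq_mul]

end LinearGroup

end MultFree

/-! Let `p` be the characteristic of `K`. The order of `U` is a power of `p`, and `p = 0` in `F`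
would force `ψ = 1`, so `F[G]` contains the idempotent `e` of `η_ψ`. A `U`-map `π → η_ψ` is
determined on `e V`. If `e F[G] e` is commutative, then `e V` is at most a line, because `F` is
algebraically closed (`exists_forall_idempotent_apply_eq_smul`).

Commutativity is Gelfand's trick (`hecke_commute`). Reflection in the antidiagonal is an
anti-automorphism preserving `U` and `η_ψ`, so it suffices that it fix every `e g e`. By Bruhat
elimination `g` may be taken to be a monomial matrix `m`, with entry `c j` at `(σ j, j)`. If `i < j`
and `σ i < σ j`, then `m (1 + x E_{i,j}) = (1 + x (c i / c j) E_{σ i, σ j}) m`, and `e m e` vanishes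
unless `η_ψ` agrees on the two unipotent factors for all `x`. This agreement forces `σ` followed by
reversal to reverse consecutive intervals, with `c` constant on each (`rev_perm_involutive`), and
then `m` is fixed by the reflection.

The statement on the induced representation follows by Frobenius reciprocity. -/

namespace MultFree

/-! ### Idempotents of characters and Gelfand's trick -/

section Gelfand

open MonoidAlgebra
open scoped TensorProduct

variable {F : Type*} [Field F] {G : Type*} [Group G]

/-- The element `|H|⁻¹ ∑ χ(h)⁻¹ h` of the group algebra, which projects onto the `χ`-isotypic part
of the restriction to `H`. -/
noncomputable def charIdempotent (H : Subgroup G) [Fintype H] (χ : H →* F) : MonoidAlgebra F G :=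
  (Fintype.card H : F)⁻¹ • ∑ h : H, χ h⁻¹ • of F G (h : G)

theorem map_inv_mul_map {H : Type*} [Group H] (χ : H →* F) (h : H) : χ h⁻¹ * χ h = 1 := by
  rw [← map_mul, inv_mul_cancel, map_one]

variable {H : Subgroup G} [Fintype H] {χ : H →* F}

theorem of_mul_charIdempotent (h : H) :
    of F G (h : G) * charIdempotent H χ = χ h • charIdempotent H χ := by
  rw [charIdempotent, mul_smul_comm, smul_comm (χ h), Finset.mul_sum, Finset.smul_sum (r := χ h)]
  refine congrArg _ (Fintype.sum_equiv (Equiv.mulLeft h) _ _ fun x => ?_)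
  rw [mul_smul_comm, ← map_mul, smul_smul]
  congr 1
  rw [Equiv.coe_mulLeft, mul_inv_rev, map_mul, mul_comm, mul_assoc, map_inv_mul_map, mul_one]

theorem charIdempotent_mul_of (h : H) :
    charIdempotent H χ * of F G (h : G) = χ h • charIdempotent H χ := by
  rw [charIdempotent, smul_mul_assoc, smul_comm (χ h), Finset.sum_mul, Finset.smul_sum (r := χ h)]
  refine congrArg _ (Fintype.sum_equiv (Equiv.mulRight h) _ _ fun x => ?_)
  rw [smul_mul_assoc, ← map_mul, smul_smul]
  congr 1
  rw [Equiv.coe_mulRight, mul_inv_rev, map_mul, ← mul_assoc, mul_comm (χ h), map_inv_mul_map,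
    one_mul]

theorem charIdempotent_mul_self (hH : (Fintype.card H : F) ≠ 0) :
    charIdempotent H χ * charIdempotent H χ = charIdempotent H χ := by
  nth_rw 1 [charIdempotent]
  simp_rw [smul_mul_assoc, Finset.sum_mul, smul_mul_assoc, of_mul_charIdempotent, smul_smul,
    map_inv_mul_map, one_smul]
  rw [Finset.sum_const, Finset.card_univ, ← Nat.cast_smul_eq_nsmul F, smul_smul,
    inv_mul_cancel₀ hH, one_smul]

/-- The anti-homomorphism of the group algebra induced by an anti-homomorphism of the group. -/
noncomputable def antiMap (F : Type*) [Field F] (τ : G →* Gᵐᵒᵖ) :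
    MonoidAlgebra F G →ₐ[F] (MonoidAlgebra F G)ᵐᵒᵖ :=
  MonoidAlgebra.lift F _ G ((MonoidHom.op (of F G)).comp τ)

theorem antiMap_of (τ : G →* Gᵐᵒᵖ) (g : G) :
    antiMap F τ (of F G g) = MulOpposite.op (of F G (τ g).unop) := by
  simp [antiMap]

theorem antiMap_charIdempotent {τ : G →* Gᵐᵒᵖ} (t : H ≃ H)
    (ht : ∀ h : H, ((t h : H) : G) = (τ h).unop) (hχ : ∀ h : H, χ (t h) = χ h) :
    antiMap F τ (charIdempotent H χ) = MulOpposite.op (charIdempotent H χ) := by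
  have hinv (h : H) : χ (t h)⁻¹ = χ h⁻¹ := by
    have h1 := map_inv_mul_map χ (t h)
    have h2 := map_inv_mul_map χ h
    rw [hχ] at h1
    exact mul_right_cancel₀ (right_ne_zero_of_mul_eq_one h1) (h1.trans h2.symm)
  simp only [charIdempotent, map_smul, map_sum, antiMap_of, MulOpposite.op_smul,
    ← MulOpposite.opAddEquiv_apply]
  refine congrArg _ (Fintype.sum_equiv t _ _ fun h => ?_)
  rw [hinv, ht]
  rfl

/-- The Gelfand trick: if an anti-homomorphism preserves `χ` and fixes every double coset
supporting a `χ`-bi-equivariant function, then the Hecke algebra is commutative. -/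
theorem hecke_commute {τ : G →* Gᵐᵒᵖ} (t : H ≃ H)
    (ht : ∀ h : H, ((t h : H) : G) = (τ h).unop) (hχ : ∀ h : H, χ (t h) = χ h)
    (hG : ∀ g : G, ∃ (m : G) (h h' : H), g = h * m * h' ∧
      ((τ m).unop = m ∨ ∃ u u' : H, m * u = u' * m ∧ χ u ≠ χ u'))
    (hH : (Fintype.card H : F) ≠ 0) (a b : MonoidAlgebra F G) :
    Commute (charIdempotent H χ * a * charIdempotent H χ)
      (charIdempotent H χ * b * charIdempotent H χ) := by
  set e := charIdempotent H χ with he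
  have hTe : antiMap F τ e = MulOpposite.op e := antiMap_charIdempotent t ht hχ
  have key (m : G) (hm : (τ m).unop = m ∨ ∃ u u' : H, m * u = u' * m ∧ χ u ≠ χ u') :
      antiMap F τ (e * of F G m * e) = MulOpposite.op (e * of F G m * e) := by
    rcases hm with hm | ⟨u, u', hu, hne⟩
    · rw [map_mul, map_mul, hTe, antiMap_of, hm, ← MulOpposite.op_mul, ← MulOpposite.op_mul,
        mul_assoc]
    -- Moving `u` across `m` makes `e m e` scale by both `χ u` and `χ u'`, so it vanishes.
    · have h0 : e * of F G m * e = 0 := by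
        have h1 : χ u • (e * of F G m * e) = χ u' • (e * of F G m * e) := by
          calc χ u • (e * of F G m * e) = e * of F G m * (of F G u * e) := by
                rw [he, of_mul_charIdempotent, mul_smul_comm]
            _ = e * (of F G m * of F G u) * e := by simp only [mul_assoc]
            _ = e * of F G u' * of F G m * e := by
                rw [← map_mul, hu, map_mul]; simp only [mul_assoc]
            _ = χ u' • (e * of F G m * e) := by
                rw [he, charIdempotent_mul_of, smul_mul_assoc, smul_mul_assoc]
        rw [← sub_eq_zero, ← sub_smul] at h1
        exact (smul_eq_zero.mp h1).resolve_left (sub_ne_zero.mpr hne)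
      rw [h0, map_zero, MulOpposite.op_zero]
  have fix (a : MonoidAlgebra F G) : antiMap F τ (e * a * e) = MulOpposite.op (e * a * e) := by
    induction a using MonoidAlgebra.induction_on with
    | of g =>
      obtain ⟨m, h, h', rfl, hm⟩ := hG g
      have : e * of F G (h * m * h') * e = (χ h * χ h') • (e * of F G m * e) := by
        calc e * of F G (h * m * h') * e = (e * of F G h) * of F G m * (of F G h' * e) := by
              simp only [map_mul, mul_assoc]
          _ = _ := by
              rw [he, of_mul_charIdempotent, charIdempotent_mul_of, smul_mul_assoc,
                smul_mul_assoc, mul_smul_comm, smul_smul]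
      rw [this, map_smul, key m hm, MulOpposite.op_smul]
    | add a b ha hb => rw [mul_add, add_mul, map_add, ha, hb, MulOpposite.op_add]
    | smul r a ha => rw [mul_smul_comm, smul_mul_assoc, map_smul, ha, MulOpposite.op_smul]
  have hee : e * e = e := charIdempotent_mul_self hH
  have hprod : (e * a * e) * (e * b * e) = e * (a * e * b) * e := by
    calc (e * a * e) * (e * b * e) = e * (a * (e * e) * b) * e := by simp only [mul_assoc]
      _ = _ := by rw [hee]
  -- The anti-homomorphism fixes both factors and their product, yet reverses products.
  have := fix (a * e * b)
  rw [← hprod, map_mul, fix, fix, ← MulOpposite.op_mul] at this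
  exact (MulOpposite.op_injective this).symm

/-! ### Irreducible representations and commutative corners -/

section Irreducible

variable {V : Type*} [AddCommGroup V] [Module F V] (π : Representation F G V)

theorem exists_asAlgebraHom_apply_eq (hπ : π.IsIrreducible) {v : V} (hv : v ≠ 0) (w : V) :
    ∃ a : MonoidAlgebra F G, π.asAlgebraHom a v = w := by
  let S : Subrepresentation π :=
    { toSubmodule := LinearMap.range ((LinearMap.applyₗ v).comp π.asAlgebraHom.toLinearMap)
      apply_mem_toSubmodule := by
        rintro g _ ⟨a, rfl⟩
        exact ⟨of F G g * a, by simp⟩ }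
  have hS : S = ⊤ := by
    refine (hπ.eq_bot_or_eq_top S).resolve_left fun h => hv ?_
    have : v ∈ S := ⟨1, by simp⟩
    rw [h] at this
    exact this
  have : w ∈ S := hS ▸ trivial
  exact this

theorem finiteDimensional_of_isIrreducible [Finite G] (hπ : π.IsIrreducible) :
    FiniteDimensional F V := by
  rcases subsingleton_or_nontrivial V with h | h
  · infer_instance
  · obtain ⟨v, hv⟩ := exists_ne (0 : V)
    have : Module.Finite F (MonoidAlgebra F G) := inferInstance
    exact Module.Finite.of_surjective ((LinearMap.applyₗ v).comp π.asAlgebraHom.toLinearMap)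
      fun w => exists_asAlgebraHom_apply_eq π hπ hv w

/-- If `e` is an idempotent of `F[G]` with `e F[G] e` commutative, then `e V` is at most
one-dimensional for every irreducible `V`. -/
theorem exists_forall_idempotent_apply_eq_smul [IsAlgClosed F] [Finite G]
    (hπ : π.IsIrreducible) {e : MonoidAlgebra F G} (hee : e * e = e)
    (hcomm : ∀ a b, Commute (e * a * e) (e * b * e)) :
    ∃ w : V, ∀ v, ∃ c : F, π.asAlgebraHom e v = c • w := by
  have := finiteDimensional_of_isIrreducible π hπ
  set A := π.asAlgebraHom with hA
  have hmul (a b : MonoidAlgebra F G) (v : V) : A (a * b) v = A a (A b v) := by simp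
  by_cases h0 : ∀ v, A e v = 0
  · exact ⟨0, fun v => ⟨0, by rw [h0, smul_zero]⟩⟩
  push Not at h0
  obtain ⟨v₀, hv₀⟩ := h0
  have hfix (v : V) : A e (A e v) = A e v := by rw [← hmul, hee]
  refine ⟨A e v₀, fun v => ?_⟩
  obtain ⟨a, ha⟩ := exists_asAlgebraHom_apply_eq π hπ hv₀ v
  let W := LinearMap.range (A e)
  have hW : ∀ x ∈ W, A (e * a * e) x ∈ W := by
    rintro x -
    rw [mul_assoc, hmul]
    exact ⟨_, rfl⟩
  have : Nontrivial W := ⟨⟨⟨A e v₀, v₀, rfl⟩, 0, fun h => hv₀ (congrArg Subtype.val h)⟩⟩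
  obtain ⟨c, hc⟩ := Module.End.exists_eigenvalue ((A (e * a * e)).restrict hW)
  obtain ⟨⟨w, hw⟩, hwc⟩ := hc.exists_hasEigenvector
  have hw0 : w ≠ 0 := fun h => hwc.2 (Subtype.ext h)
  have hwc' : A (e * a * e) w = c • w := congrArg Subtype.val hwc.apply_eq_smul
  have hew : A e w = w := by
    obtain ⟨x, rfl⟩ := hw
    exact hfix x
  -- By irreducibility some `e b e` carries the eigenvector `w` to `e v₀`. Since it commutes with `e
  -- a e`, the vector `e v₀` has eigenvalue `c` too, while `e a e` sends `e v₀` to `e v`.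
  obtain ⟨b, hb⟩ := exists_asAlgebraHom_apply_eq π hπ hw0 (A e v₀)
  have hb' : A (e * b * e) w = A e v₀ := by
    rw [hmul, hew, hmul, hb, hfix]
  refine ⟨c, ?_⟩
  calc A e v = A (e * a * e) (A e v₀) := by rw [hmul, hfix, hmul]; rw [← ha]
    _ = A (e * b * e) (A (e * a * e) w) := by
        rw [← hb', ← hmul, (hcomm a b).eq, hmul]
    _ = c • A e v₀ := by rw [hwc', map_smul, hb']

end Irreducible

/-- An intertwiner `f` satisfies `f (e v) = f v`, and `e V` lies in the line of a single `w`, so `f`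
is determined by `f w`. -/
theorem isTwistedGelfandPair_of_commute [IsAlgClosed F] [Finite G]
    (hH : (Fintype.card H : F) ≠ 0)
    (hcomm : ∀ a b, Commute (charIdempotent H χ * a * charIdempotent H χ)
      (charIdempotent H χ * b * charIdempotent H χ)) :
    IsTwistedGelfandPair.{w} H χ := by
  intro V _ _ π hπ
  obtain ⟨w, hw⟩ := exists_forall_idempotent_apply_eq_smul π hπ (charIdempotent_mul_self hH) hcomm
  let i : Representation.IntertwiningMap (π.comp H.subtype) (characterRep χ) →ₗ[F] F :=
    { toFun := fun f => f w
      map_add' := fun f g => by simp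
      map_smul' := fun r f => by simp }
  have hf (f : Representation.IntertwiningMap (π.comp H.subtype) (characterRep χ)) (v : V) :
      f (π.asAlgebraHom (charIdempotent H χ) v) = f v := by
    have hh (h : H) : f (π h v) = χ h * f v := Representation.IntertwiningMap.isIntertwining _ _ f h v
    simp only [charIdempotent, map_smul, map_sum, LinearMap.smul_apply, LinearMap.sum_apply,
      Representation.asAlgebraHom_of, hh, smul_eq_mul]
    simp_rw [← mul_assoc (χ _), map_inv_mul_map, one_mul]
    rw [Finset.sum_const, Finset.card_univ, nsmul_eq_mul, inv_mul_cancel_left₀ hH]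
  have hi : Function.Injective i := by
    rw [injective_iff_map_eq_zero]
    intro f h0
    refine DFunLike.ext _ _ fun v => ?_
    obtain ⟨c, hc⟩ := hw v
    rw [← hf, hc, map_smul, show f w = 0 from h0, smul_zero]
    rfl
  have := LinearMap.lift_rank_le_of_injective i hi
  rwa [Module.rank_self, Cardinal.lift_one, Cardinal.lift_le_one_iff] at this

/-! ### Frobenius reciprocity for the induced character -/

open Classical in
/-- The function on `G` that is `χ⁻¹` on `H` and zero outside `H`. -/
noncomputable def invCharOn (H : Subgroup G) (χ : H →* F) (g : G) : F :=
  if h : g ∈ H then χ ⟨g, h⟩⁻¹ else 0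

omit [Fintype H] in
theorem invCharOn_mul (h : H) (g : G) : invCharOn H χ (h * g) = invCharOn H χ g * χ h⁻¹ := by
  unfold invCharOn
  by_cases hg : g ∈ H
  · rw [dif_pos hg, dif_pos (H.mul_mem h.2 hg), ← map_mul, ← mul_inv_rev]
    rfl
  · rw [dif_neg hg, dif_neg (by rwa [H.mul_mem_cancel_left h.2]), zero_mul]

omit [Fintype H] in
theorem invCharOn_mul_inv (g : G) (h : H) :
    invCharOn H χ (g * (h : G)⁻¹) = χ h * invCharOn H χ g := by
  unfold invCharOn
  by_cases hg : g ∈ H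
  · rw [dif_pos hg, dif_pos (H.mul_mem hg (H.inv_mem h.2)), ← map_mul]
    refine congrArg χ (Subtype.ext ?_)
    simp
  · rw [dif_neg hg, dif_neg (by rwa [H.mul_mem_cancel_right (H.inv_mem h.2)]), mul_zero]

/-- The evaluation at the identity coset of the induced representation of a character. -/
noncomputable def indEval (H : Subgroup G) (χ : H →* F) :
    Representation.IndV H.subtype (characterRep χ) →ₗ[F] F :=
  Representation.Coinvariants.lift _
    (TensorProduct.lift ((LinearMap.mul F F).comp
      ((Finsupp.linearCombination F (invCharOn H χ)).comp
        (MonoidAlgebra.coeffLinearEquiv F).toLinearMap))) (by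
    intro h
    ext g
    have hne : χ h ≠ 0 := right_ne_zero_of_mul_eq_one (map_inv_mul_map χ h)
    simp [characterRep, invCharOn_mul, hne])

omit [Fintype H] in
theorem indEval_mk (g : G) (a : F) :
    indEval H χ (Representation.IndV.mk _ _ g a) = invCharOn H χ g * a := by
  simp [indEval]

omit [Fintype H] in
theorem indEval_ind (h : H) (x : Representation.IndV H.subtype (characterRep χ)) :
    indEval H χ (Representation.ind H.subtype (characterRep χ) h x) = χ h * indEval H χ x := by
  suffices (indEval H χ) ∘ₗ (Representation.ind H.subtype (characterRep χ) h) =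
      χ h • indEval H χ from LinearMap.congr_fun this x
  refine Representation.IndV.hom_ext _ _ fun g => LinearMap.ext fun a => ?_
  change indEval H χ (Representation.ind H.subtype (characterRep χ) h
    (Representation.IndV.mk _ _ g a)) = χ h * indEval H χ (Representation.IndV.mk _ _ g a)
  rw [Representation.ind_mk, indEval_mk, indEval_mk, invCharOn_mul_inv, mul_assoc]

/-- An element of the induced representation is recovered from its values at the cosets. -/
theorem sum_mk_indEval [Fintype G] (x : Representation.IndV H.subtype (characterRep χ)) :
    ∑ g : G, Representation.IndV.mk H.subtype (characterRep χ) g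
      (indEval H χ (Representation.ind H.subtype (characterRep χ) g x)) =
      (Fintype.card H : F) • x := by
  suffices ∑ g : G, Representation.IndV.mk H.subtype (characterRep χ) g ∘ₗ
      indEval H χ ∘ₗ Representation.ind H.subtype (characterRep χ) g =
      (Fintype.card H : F) • LinearMap.id by
    have := LinearMap.congr_fun this x
    rw [LinearMap.sum_apply] at this
    exact this
  refine Representation.IndV.hom_ext _ _ fun k => LinearMap.ext fun a => ?_
  change (∑ g : G, Representation.IndV.mk H.subtype (characterRep χ) g ∘ₗ
      indEval H χ ∘ₗ Representation.ind H.subtype (characterRep χ) g)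
        (Representation.IndV.mk _ _ k a) =
      (Fintype.card H : F) • Representation.IndV.mk _ _ k a
  rw [LinearMap.sum_apply]
  change ∑ g : G, Representation.IndV.mk H.subtype (characterRep χ) g
      (indEval H χ (Representation.ind H.subtype (characterRep χ) g
        (Representation.IndV.mk _ _ k a))) = _
  simp_rw [Representation.ind_mk, indEval_mk]
  -- Since `h⁻¹` acts trivially on coinvariants, each term with `k * g⁻¹ ∈ H` equals `mk k a`. The
  -- other terms vanish, leaving `|H|` copies.
  have hmk (h : H) : Representation.IndV.mk H.subtype (characterRep χ) ((h : G)⁻¹ * k)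
      (χ h⁻¹ * a) = Representation.IndV.mk H.subtype (characterRep χ) k a := by
    have := Representation.Coinvariants.mk_self_apply
      (Representation.tprod ((Representation.leftRegular F G).comp H.subtype) (characterRep χ))
      h⁻¹ (MonoidAlgebra.single k 1 ⊗ₜ a)
    refine Eq.trans ?_ this
    simp [characterRep]
    rfl
  classical
  calc ∑ g : G, Representation.IndV.mk H.subtype (characterRep χ) g
        (invCharOn H χ (k * g⁻¹) * a)
      = ∑ g : G, if g ∈ H then Representation.IndV.mk H.subtype (characterRep χ) k a else 0 := by
        refine Fintype.sum_equiv ((Equiv.inv G).trans (Equiv.mulLeft k)) _ _ fun g => ?_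
        rw [Equiv.trans_apply, Equiv.inv_apply, Equiv.coe_mulLeft]
        split_ifs with hg
        · rw [invCharOn, dif_pos hg, ← hmk ⟨_, hg⟩]
          congr 1
          simp
        · rw [invCharOn, dif_neg hg, zero_mul, map_zero]
    _ = _ := by
        rw [← Finset.sum_filter, Finset.sum_const, ← Nat.cast_smul_eq_nsmul F,
          Fintype.card_subtype]

/-- Composition with `indEval` embeds one Hom space in the other: by `sum_mk_indEval` the values on
translates of `f v` determine `|H| • f v`, and `|H|` is invertible. -/
theorem isMultiplicityFreeTriple_of_isTwistedGelfandPair [Finite G]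
    (hH : (Fintype.card H : F) ≠ 0) (h : IsTwistedGelfandPair.{w} H χ) :
    IsMultiplicityFreeTriple.{w} H (characterRep χ) := by
  intro V _ _ π hπ
  have := Fintype.ofFinite G
  let i : Representation.IntertwiningMap π (Representation.ind H.subtype (characterRep χ)) →ₗ[F]
      Representation.IntertwiningMap (π.comp H.subtype) (characterRep χ) :=
    { toFun := fun f => LinearMap.intertwiningMap_of_isIntertwiningMap _ _
        (indEval H χ ∘ₗ f.toLinearMap) fun g v => by
          refine Eq.trans (congrArg (indEval H χ) ?_) (indEval_ind g (f v))
          exact Representation.IntertwiningMap.isIntertwining _ _ f g v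
      map_add' := fun f g => by ext; simp
      map_smul' := fun r f => by ext; simp }
  have hi : Function.Injective i := by
    rw [injective_iff_map_eq_zero]
    intro f h0
    refine DFunLike.ext _ _ fun v => ?_
    have h1 (v : V) : indEval H χ (f v) = 0 := DFunLike.congr_fun h0 v
    have h2 := sum_mk_indEval (f v)
    simp only [← Representation.IntertwiningMap.isIntertwining, h1, map_zero,
      Finset.sum_const_zero] at h2
    exact (smul_eq_zero.mp h2.symm).resolve_left hH
  have h1 := LinearMap.lift_rank_le_of_injective i hi
  have h2 := Cardinal.lift_le_one_iff.mpr (h V π hπ)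
  exact Cardinal.lift_le_one_iff.mp (h1.trans h2)

end Gelfand

/-! ### Permutations that reverse consecutive intervals -/

section BlockReversal

/-- If a map on `{0, …, n-1}` decreases by at most one at each step, then
`v i ≤ v j + (j - i)` for `i ≤ j`. -/
theorem le_add_sub_of_step {n : ℕ} {v : ℕ → ℕ}
    (h : ∀ i, i + 1 < n → v i ≤ v (i + 1) + 1) {i j : ℕ} (hij : i ≤ j) (hj : j < n) :
    v i ≤ v j + (j - i) := by
  induction j, hij using Nat.le_induction with
  | base => simp
  | succ j hij ih =>
    have := ih (by omega)
    have := h j hj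
    omega

/-- A permutation of `{0, …, n-1}` that, like its inverse, decreases by at most one at each step
reverses each interval in some partition into consecutive intervals. -/
theorem exists_block_reversal {n : ℕ} {v u : ℕ → ℕ}
    (hv : ∀ i < n, v i < n) (hu : ∀ i < n, u i < n)
    (huv : ∀ i < n, u (v i) = i) (hvu : ∀ i < n, v (u i) = i)
    (hv1 : ∀ i, i + 1 < n → v i ≤ v (i + 1) + 1) (hu1 : ∀ i, i + 1 < n → u i ≤ u (i + 1) + 1)
    {i : ℕ} (hi : i < n) :
    ∃ k l, k ≤ i ∧ i < l ∧ l ≤ n ∧ (∀ j < l, v j < l) ∧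
      ∀ j, k ≤ j → j < l → v j = k + l - 1 - j := by
  -- Blocks are peeled off from the left: once `{0, …, k-1}` is stable under `v`, the next block is
  -- `[k, v k]`.
  have step (k : ℕ) (hk : k < n) (hpre : ∀ j < k, v j < k) :
      ∃ l, k < l ∧ l ≤ n ∧ (∀ j < l, v j < l) ∧ ∀ j, k ≤ j → j < l → v j = k + l - 1 - j := by
    have hmaps : Set.SurjOn v (Finset.range k) (Finset.range k) := by
      refine Finset.surjOn_of_injOn_of_card_le v (fun j hj => ?_) (fun a ha b hb hab => ?_) le_rfl
      · simpa using hpre j (by simpa using hj)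
      · simp only [Finset.coe_range, Set.mem_Iio] at ha hb
        rw [← huv a (by omega), ← huv b (by omega), hab]
    have hge (j : ℕ) (hj : k ≤ j) (hjn : j < n) : k ≤ v j := by
      by_contra hlt
      obtain ⟨m, hm, hmj⟩ := hmaps (show v j ∈ (Finset.range k : Set ℕ) by simpa using hlt)
      simp only [Finset.coe_range, Set.mem_Iio] at hm
      have : m = j := by rw [← huv m (by omega), ← huv j hjn, hmj]
      omega
    have hka : k ≤ v k := hge k le_rfl hk
    have hkb : k ≤ u k := by
      by_contra hlt
      have := hpre (u k) (by omega)
      rw [hvu k hk] at this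
      omega
    -- From position `k` to `u k` the values of `v` go from `v k` to `k`, losing at most one per
    -- step, so `v k ≤ u k`. The symmetric bound gives equality.
    have h1 := le_add_sub_of_step hv1 hkb (hu k hk)
    have h2 := le_add_sub_of_step hu1 hka (hv k hk)
    rw [hvu k hk] at h1
    rw [huv k hk] at h2
    have hab : v k = u k := by omega
    have hvv : v (v k) = k := by rw [hab, hvu k hk]
    have hvk := hv k hk
    -- A total drop of `v k - k` over as many steps leaves no slack: each step drops by exactly one.
    have hblock (j : ℕ) (h1 : k ≤ j) (h2 : j < v k + 1) : v j = k + (v k + 1) - 1 - j := by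
      have := le_add_sub_of_step hv1 h1 (by omega)
      have := le_add_sub_of_step hv1 (show j ≤ v k by omega) hvk
      omega
    refine ⟨v k + 1, by omega, by omega, fun j hj => ?_, hblock⟩
    rcases lt_or_ge j k with hjk | hjk
    · have := hpre j hjk
      omega
    · have := hblock j hjk hj
      omega
  induction i with
  | zero =>
    obtain ⟨l, h⟩ := step 0 hi (by simp)
    exact ⟨0, l, by simpa using h⟩
  | succ i ih =>
    obtain ⟨k, l, hki, hil, hln, hpre, hblock⟩ := ih (by omega)
    rcases lt_or_ge (i + 1) l with h | h
    · exact ⟨k, l, by omega, h, hln, hpre, hblock⟩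
    · obtain rfl : l = i + 1 := by omega
      obtain ⟨l', h'⟩ := step (i + 1) hi hpre
      exact ⟨i + 1, l', le_rfl, h'⟩

/-- Permutations `σ` of `Fin n` with `σ i < σ j` only at forced places are, after reversal,
involutions, and a compatible coefficient function is invariant under this involution. -/
theorem rev_perm_involutive {n : ℕ} {A : Type*} (σ : Equiv.Perm (Fin n)) (c : Fin n → A)
    (h1 : ∀ i j : Fin n, (i : ℕ) + 1 = j → σ i < σ j → (σ i : ℕ) + 1 = σ j ∧ c i = c j)
    (h2 : ∀ i j : Fin n, i < j → (σ i : ℕ) + 1 = σ j → (i : ℕ) + 1 = j) (i : Fin n) :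
    σ (σ i).rev = i.rev ∧ c (σ i).rev = c i := by
  -- `v` is `σ` followed by reversal, and `u` is its inverse. Rises of `σ` by one become drops by
  -- one. Values outside `{0, …, n-1}` play no role.
  let v : ℕ → ℕ := fun m => if h : m < n then (σ ⟨m, h⟩).rev else m
  let u : ℕ → ℕ := fun m => if h : m < n then σ.symm (Fin.rev ⟨m, h⟩) else m
  have vfin (j : Fin n) : v j = (σ j).rev := dif_pos j.2
  have ufin (j : Fin n) : u j = σ.symm j.rev := dif_pos j.2
  have hv1 (j : ℕ) (hj : j + 1 < n) : v j ≤ v (j + 1) + 1 := by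
    have e1 := vfin ⟨j, by omega⟩
    have e2 := vfin ⟨j + 1, hj⟩
    simp only [Fin.val_rev] at e1 e2
    have := h1 ⟨j, by omega⟩ ⟨j + 1, hj⟩ rfl
    rw [Fin.lt_def] at this
    have := (σ ⟨j, by omega⟩).2
    have := (σ ⟨j + 1, hj⟩).2
    omega
  have hu1 (j : ℕ) (hj : j + 1 < n) : u j ≤ u (j + 1) + 1 := by
    have e1 := ufin ⟨j, by omega⟩
    have e2 := ufin ⟨j + 1, hj⟩
    have := h2 (σ.symm (Fin.rev ⟨j + 1, hj⟩)) (σ.symm (Fin.rev ⟨j, by omega⟩))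
    simp only [Equiv.apply_symm_apply, Fin.lt_def, Fin.val_rev] at this e1 e2
    omega
  obtain ⟨k, l, hki, hil, hln, -, hblock⟩ := exists_block_reversal (v := v) (u := u)
    (fun j hj => by have := vfin ⟨j, hj⟩; simp only at this; rw [this]; exact Fin.is_lt _)
    (fun j hj => by have := ufin ⟨j, hj⟩; simp only at this; rw [this]; exact Fin.is_lt _)
    (fun j hj => by
      have := vfin ⟨j, hj⟩
      simp only at this
      rw [this, ufin, Fin.rev_rev, Equiv.symm_apply_apply])
    (fun j hj => by
      have := ufin ⟨j, hj⟩
      simp only at this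
      rw [this, vfin, Equiv.apply_symm_apply, Fin.rev_rev]) hv1 hu1 i.2
  have hvi := hblock i hki hil
  have hvvi := hblock (v i) (by omega) (by omega)
  rw [vfin i, vfin] at hvvi
  rw [vfin i] at hvi
  constructor
  · have : (σ (σ i).rev).rev = i := Fin.ext (by omega)
    rw [← this, Fin.rev_rev, this]
  -- Inside a block `σ` rises at each step, so `h1` equates neighbouring coefficients.
  · have hconst (j : ℕ) (hkj : k ≤ j) (hjl : j < l) :
        c ⟨j, by omega⟩ = c ⟨k, by omega⟩ := by
      induction j, hkj using Nat.le_induction with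
      | base => rfl
      | succ j hkj ih =>
        rw [← ih (by omega)]
        refine ((h1 ⟨j, by omega⟩ ⟨j + 1, by omega⟩ rfl ?_).2).symm
        have e1 := hblock j hkj (by omega)
        have e2 := hblock (j + 1) (by omega) hjl
        have e3 := vfin ⟨j, by omega⟩
        have e4 := vfin ⟨j + 1, by omega⟩
        simp only [Fin.val_rev] at e3 e4
        rw [Fin.lt_def]
        omega
    exact (hconst (σ i).rev (by omega) (by omega)).trans (hconst i hki hil).symm

end BlockReversal

/-! ### Bruhat decomposition by elimination -/

section Bruhat

open Matrix

variable {n : ℕ} {K : Type*} [Field K]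

/-- The element `1 + x yᵀ` of the unipotent subgroup, for vectors `x` and `y` such that `x yᵀ` is
strictly upper triangular. -/
def unipotentOneAdd (x y : Fin n → K) (h : ∀ i j, j ≤ i → x i * y j = 0) : unipotent n K :=
  have h2 : vecMulVec x y * vecMulVec x y = 0 := by
    have : y ⬝ᵥ x = 0 := Finset.sum_eq_zero fun i _ => by rw [mul_comm, h i i le_rfl]
    rw [vecMulVec_mul_vecMulVec, this, zero_smul, vecMulVec_zero]
  ⟨⟨1 + vecMulVec x y, 1 - vecMulVec x y, by simp [add_mul, mul_sub, h2],
    by simp [sub_mul, mul_add, h2]⟩, fun i => by simp [vecMulVec_apply, h i i le_rfl],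
    fun i j hij => by simp [vecMulVec_apply, h i j hij.le, one_apply_ne hij.ne']⟩

theorem coe_unipotentOneAdd (x y : Fin n → K) (h : ∀ i j, j ≤ i → x i * y j = 0) :
    ((unipotentOneAdd x y h : GL (Fin n) K) : Matrix (Fin n) (Fin n) K) = 1 + vecMulVec x y :=
  rfl

theorem unipotentOneAdd_single_mul (x : Fin n → K) (r : Fin n)
    (h : ∀ i j, j ≤ i → x i * (Pi.single r 1 : Fin n → K) j = 0) (M : GL (Fin n) K)
    (i j : Fin n) :
    ((unipotentOneAdd x (Pi.single r 1) h : GL (Fin n) K) * M : GL (Fin n) K).val i j =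
      M.val i j + x i * M.val r j := by
  rw [Units.val_mul, coe_unipotentOneAdd, add_mul, one_mul, Matrix.add_apply, vecMulVec_mul,
    vecMulVec_apply, single_one_vecMul]
  rfl

theorem mul_unipotentOneAdd_single (y : Fin n → K) (r : Fin n)
    (h : ∀ i j, j ≤ i → (Pi.single r 1 : Fin n → K) i * y j = 0) (M : GL (Fin n) K)
    (i j : Fin n) :
    (M * (unipotentOneAdd (Pi.single r 1) y h : GL (Fin n) K) : GL (Fin n) K).val i j =
      M.val i j + M.val i r * y j := by
  rw [Units.val_mul, coe_unipotentOneAdd, mul_add, mul_one, Matrix.add_apply, mul_vecMulVec,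
    vecMulVec_apply, mulVec_single_one]
  rfl

theorem exists_apply_ne_zero (g : GL (Fin n) K) (k : Fin n) : ∃ i, g.val i k ≠ 0 := by
  by_contra! h
  have : (g⁻¹.val * g.val) k k = 1 := by simp
  rw [mul_apply, Finset.sum_eq_zero fun j _ => by rw [h j, mul_zero]] at this
  exact zero_ne_one this

/-- Two-sided elimination by unipotent upper triangular matrices, on the first `k` columns. -/
theorem exists_unipotent_mul_mul (g : GL (Fin n) K) {k : ℕ} (hk : k ≤ n) :
    ∃ u u' : unipotent n K, ∀ j : Fin n, (j : ℕ) < k → ∃ r,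
      (u * g * u' : GL (Fin n) K).val r j ≠ 0 ∧
      (∀ i, i ≠ r → (u * g * u' : GL (Fin n) K).val i j = 0) ∧
      ∀ l, l ≠ j → (u * g * u' : GL (Fin n) K).val r l = 0 := by
  induction k with
  | zero => exact ⟨1, 1, fun j hj => absurd hj (Nat.not_lt_zero _)⟩
  | succ k ih =>
    obtain ⟨u, u', hM⟩ := ih (by omega)
    set M : GL (Fin n) K := u * g * u' with hMdef
    let p : Fin n := ⟨k, hk⟩
    -- With the lowest nonzero entry of column `p` as pivot, only entries above it and to its right
    -- need clearing, which upper unipotent factors can do.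
    obtain ⟨r, hr, hmax⟩ : ∃ r, M.val r p ≠ 0 ∧ ∀ i, r < i → M.val i p = 0 := by
      classical
      obtain ⟨r, hr⟩ := (Finset.univ.filter fun i => M.val i p ≠ 0).exists_maximal
        (by simpa [Finset.Nonempty] using exists_apply_ne_zero M p)
      refine ⟨r, by simpa using hr.1, fun i hi => ?_⟩
      by_contra h
      exact absurd (hr.2 (by simpa using h) hi.le) (not_le.mpr hi)
    let x : Fin n → K := fun i => if i < r then -(M.val i p / M.val r p) else 0
    let y : Fin n → K := fun l => if p < l then -(M.val r l / M.val r p) else 0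
    have hx : ∀ i j, j ≤ i → x i * (Pi.single r 1 : Fin n → K) j = 0 := by
      intro i j hij
      by_cases hjr : j = r
      · subst hjr; simp [x, not_lt.mpr hij]
      · simp [hjr]
    have hy : ∀ i j, j ≤ i → (Pi.single p 1 : Fin n → K) i * y j = 0 := by
      intro i j hij
      by_cases hip : i = p
      · subst hip; simp [y, not_lt.mpr hij]
      · simp [hip]
    have hM'col (i : Fin n) : M.val i p + x i * M.val r p = if i = r then M.val r p else 0 := by
      rcases lt_trichotomy i r with h | rfl | h
      · simp [x, h, h.ne, div_mul_cancel₀ _ hr]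
      · simp [x]
      · simp [x, h.not_gt, h.ne', hmax i h]
    refine ⟨unipotentOneAdd x _ hx * u, u' * unipotentOneAdd _ y hy, ?_⟩
    have hN (i l : Fin n) :
        ((unipotentOneAdd x _ hx * u : unipotent n K) * g *
          (u' * unipotentOneAdd _ y hy : unipotent n K) : GL (Fin n) K).val i l =
        M.val i l + x i * M.val r l + (if i = r then M.val r p else 0) * y l := by
      rw [← hM'col, ← unipotentOneAdd_single_mul x r hx, ← unipotentOneAdd_single_mul x r hx,
        ← mul_unipotentOneAdd_single y p hy, hMdef]
      simp only [Subgroup.coe_mul, mul_assoc]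
    simp only [hN]
    intro j hj
    rcases (Nat.lt_succ_iff_lt_or_eq.mp hj) with hj | hj
    -- The earlier pivot row `s` is zero in column `p`, and row `r` is zero in column `j`, so
    -- neither operation disturbs the earlier pivot.
    · obtain ⟨s, hs, hcol, hrow⟩ := hM j hj
      have hjp : j < p := hj
      have hsp : M.val s p = 0 := hrow p hjp.ne'
      have hsr : s ≠ r := fun h => hr (h ▸ hsp)
      have hrj : M.val r j = 0 := hcol r hsr.symm
      have hyj : y j = 0 := if_neg hjp.not_gt
      have hxs : x s = 0 := by simp [x, hsp]
      refine ⟨s, by simpa [hrj, hyj] using hs, fun i hi => by simp [hrj, hyj, hcol i hi],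
        fun l hl => by simp [hxs, hsr, hrow l hl]⟩
    · obtain rfl : j = p := Fin.ext hj
      have hyp : y p = 0 := if_neg (lt_irrefl _)
      refine ⟨r, ?_, fun i hi => ?_, fun l hl => ?_⟩
      · simpa [hM'col, hyp] using hr
      · simp [hM'col, hyp, hi]
      · have hxr : x r = 0 := if_neg (lt_irrefl _)
        -- Left of the pivot, row `r` is already zero: those columns have their only nonzero entry
        -- in another row.
        rcases lt_or_gt_of_ne hl with h | h
        · obtain ⟨s, hs, hcol, hrow⟩ := hM l h
          have hsr : s ≠ r := fun h' => hr (h' ▸ hrow p h.ne')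
          simp [hxr, hcol r hsr.symm, y, h.not_gt]
        · simp [hxr, y, h, mul_div_cancel₀ _ hr]

/-- The Bruhat decomposition: every invertible matrix is a product of a unipotent upper triangular,
a monomial, and a unipotent upper triangular matrix. -/
theorem exists_eq_unipotent_mul_monomial_mul_unipotent (g : GL (Fin n) K) :
    ∃ (M : GL (Fin n) K) (u u' : unipotent n K) (σ : Equiv.Perm (Fin n)) (c : Fin n → K),
      g = u * M * u' ∧ (∀ j, c j ≠ 0) ∧ ∀ i j, M.val i j = if i = σ j then c j else 0 := by
  obtain ⟨u, u', h⟩ := exists_unipotent_mul_mul g le_rfl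
  set M : GL (Fin n) K := u * g * u' with hM
  choose s hs hcol hrow using fun j => h j j.2
  have hinj : Function.Injective s := by
    intro i j hij
    by_contra hne
    exact hs i (hij ▸ hrow j i hne)
  refine ⟨M, u⁻¹, u'⁻¹, Equiv.ofBijective s hinj.bijective_of_finite, fun j => M.val (s j) j,
    ?_, hs, fun i j => ?_⟩
  · rw [hM, Subgroup.coe_inv, Subgroup.coe_inv]
    group
  · rw [Equiv.ofBijective_apply]
    split_ifs with hij
    · rw [hij]
    · exact hcol j i hij

end Bruhat

/-! ### The antidiagonal reflection and monomial matrices -/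

section Reflection

open Matrix

variable {n : ℕ} {K : Type*} [Field K]

/-- The reflection of matrices across the antidiagonal, an anti-automorphism of `GL_n(K)`. -/
def antiReflection (n : ℕ) (K : Type*) [Field K] : GL (Fin n) K →* (GL (Fin n) K)ᵐᵒᵖ :=
  (Units.opEquiv : (Matrix (Fin n) (Fin n) K)ᵐᵒᵖˣ ≃* _).toMonoidHom.comp (Units.map
    { toFun := fun M => MulOpposite.op (Mᵀ.submatrix Fin.rev Fin.rev)
      map_one' := by
        rw [transpose_one, submatrix_one _ Fin.rev_injective, MulOpposite.op_one]
      map_mul' := fun M N => by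
        rw [← MulOpposite.op_mul, transpose_mul,
          submatrix_mul _ _ Fin.rev Fin.rev Fin.rev Fin.rev_bijective] })

theorem antiReflection_apply (g : GL (Fin n) K) (i j : Fin n) :
    (antiReflection n K g).unop.val i j = g.val j.rev i.rev :=
  rfl

theorem antiReflection_mem_unipotent {g : GL (Fin n) K} (hg : g ∈ unipotent n K) :
    (antiReflection n K g).unop ∈ unipotent n K :=
  ⟨fun i => hg.1 i.rev, fun _ _ hij => hg.2 _ _ (Fin.rev_lt_rev.mpr hij)⟩

theorem antiReflection_antiReflection (g : GL (Fin n) K) :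
    (antiReflection n K (antiReflection n K g).unop).unop = g := by
  ext i j
  rw [antiReflection_apply, antiReflection_apply, Fin.rev_rev, Fin.rev_rev]

/-- The reflection across the antidiagonal as a permutation of the unipotent subgroup. -/
def unipotentReflection (n : ℕ) (K : Type*) [Field K] : unipotent n K ≃ unipotent n K where
  toFun u := ⟨(antiReflection n K u).unop, antiReflection_mem_unipotent u.2⟩
  invFun u := ⟨(antiReflection n K u).unop, antiReflection_mem_unipotent u.2⟩
  left_inv _ := Subtype.ext (antiReflection_antiReflection _)
  right_inv _ := Subtype.ext (antiReflection_antiReflection _)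

theorem superdiagonalSum_eq_sum (A : Matrix (Fin n) (Fin n) K) :
    superdiagonalSum A = ∑ i : Fin n, ∑ j : Fin n, if (i : ℕ) + 1 = j then A i j else 0 := by
  refine Finset.sum_congr rfl fun i _ => ?_
  split_ifs with h
  · rw [Finset.sum_eq_single ⟨i + 1, h⟩ _ (by simp)]
    · simp
    · intro j _ hj
      exact if_neg fun h' => hj (Fin.ext h'.symm)
  · refine (Finset.sum_eq_zero fun j _ => if_neg ?_).symm
    have := j.2
    omega

theorem superdiagonalSum_antiReflection (g : GL (Fin n) K) :
    superdiagonalSum (antiReflection n K g).unop.val = superdiagonalSum g.val := by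
  rw [superdiagonalSum_eq_sum, superdiagonalSum_eq_sum, Finset.sum_comm]
  refine Fintype.sum_equiv Fin.revPerm _ _ fun j => Fintype.sum_equiv Fin.revPerm _ _ fun i => ?_
  rw [antiReflection_apply, Fin.revPerm_apply, Fin.revPerm_apply]
  refine if_congr ?_ rfl rfl
  rw [Fin.val_rev, Fin.val_rev]
  omega

theorem superdiagonalSum_unipotentOneAdd_single (x : K) (i j : Fin n)
    (h : ∀ a b, b ≤ a → (Pi.single i x : Fin n → K) a * (Pi.single j 1 : Fin n → K) b = 0) :
    superdiagonalSum (unipotentOneAdd (Pi.single i x) (Pi.single j 1) h : GL (Fin n) K).val =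
      if (i : ℕ) + 1 = j then x else 0 := by
  rw [superdiagonalSum_eq_sum, Finset.sum_eq_single i _ (by simp),
    Finset.sum_eq_single j _ (by simp)]
  · refine if_ctx_congr Iff.rfl (fun hij => ?_) fun _ => rfl
    have : i ≠ j := fun h => by rw [h] at hij; omega
    simp [coe_unipotentOneAdd, vecMulVec_apply, one_apply_ne this]
  · intro b _ hb
    refine ite_eq_right_iff.mpr fun hib => ?_
    have : i ≠ b := fun h => by rw [h] at hib; omega
    simp [coe_unipotentOneAdd, vecMulVec_apply, one_apply_ne this, hb]
  · intro a _ ha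
    refine Finset.sum_eq_zero fun b _ => ite_eq_right_iff.mpr fun hab => ?_
    have : a ≠ b := fun h => by rw [h] at hab; omega
    simp [coe_unipotentOneAdd, vecMulVec_apply, one_apply_ne this, ha]

theorem single_mul_single_eq_zero {i j : Fin n} (hij : i < j) (x : K) (a b : Fin n) (hab : b ≤ a) :
    (Pi.single i x : Fin n → K) a * (Pi.single j 1 : Fin n → K) b = 0 := by
  by_cases ha : a = i
  · rw [Pi.single_eq_of_ne (show b ≠ j by rintro rfl; exact absurd (ha ▸ hab) hij.not_ge), mul_zero]
  · rw [Pi.single_eq_of_ne ha, zero_mul]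

variable {F : Type*} [Field F]

/-- If `a ≠ b`, taking `x = y / (a - b)` gives `ψ y = 1` for every `y`. -/
theorem eq_of_forall_addChar_mul_eq {ψ : AddChar K F} (hψ : ψ ≠ 1) {a b : K}
    (h : ∀ x, ψ (x * a) = ψ (x * b)) : a = b := by
  by_contra hab
  refine hψ (DFunLike.ext _ _ fun y => ?_)
  have := h (y / (a - b))
  have e : y = y / (a - b) * a - y / (a - b) * b := by
    rw [← mul_sub, div_mul_cancel₀ _ (sub_ne_zero.mpr hab)]
  have hne : ψ (y / (a - b) * b) ≠ 0 := (AddChar.val_isUnit ψ _).ne_zero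
  rw [e, AddChar.map_sub_eq_div, this, div_self hne, AddChar.one_apply]

/-- A monomial matrix is invariant under the reflection, or its double coset supports no function
that is bi-equivariant for the generic character. -/
theorem antiReflection_eq_or_exists_of_monomial {ψ : AddChar K F} (hψ : ψ ≠ 1)
    (M : GL (Fin n) K) (σ : Equiv.Perm (Fin n)) (c : Fin n → K) (hc : ∀ j, c j ≠ 0)
    (hM : ∀ i j, M.val i j = if i = σ j then c j else 0) :
    (antiReflection n K M).unop = M ∨
      ∃ u u' : unipotent n K, M * u = u' * M ∧ genericCharacter ψ u ≠ genericCharacter ψ u' := by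
  refine or_iff_not_imp_right.mpr fun hno => ?_
  push Not at hno
  have key (i j : Fin n) (hij : i < j) (hσ : σ i < σ j) :
      (if (i : ℕ) + 1 = j then (1 : K) else 0) =
        if (σ i : ℕ) + 1 = σ j then c i / c j else 0 := by
    refine eq_of_forall_addChar_mul_eq hψ fun x => ?_
    -- The factor `c i / c j` comes from `M E_{i,j} = c i E_{σ i, j}` and `E_{σ i, σ j} M = c j E_{σ
    -- i, j}`.
    have := hno (unipotentOneAdd _ _ (single_mul_single_eq_zero hij x))
      (unipotentOneAdd _ _ (single_mul_single_eq_zero hσ (x * (c i / c j)))) (by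
        ext a b
        rw [unipotentOneAdd_single_mul, Units.val_mul, coe_unipotentOneAdd, mul_add, mul_one,
          Matrix.add_apply, mul_vecMulVec, vecMulVec_apply, mulVec_single, hM]
        simp only [Pi.smul_apply, col_apply, hM, MulOpposite.smul_eq_mul_unop]
        by_cases ha : a = σ i <;> by_cases hb : b = j
        · subst ha hb; simp; field_simp [hc b]
        · simp [ha, hb, Ne.symm hb]
        · simp [ha, hb]
        · simp [ha, hb, Ne.symm hb])
    simp only [genericCharacter, MonoidHom.coe_mk, OneHom.coe_mk,
      superdiagonalSum_unipotentOneAdd_single] at this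
    simpa only [mul_ite, mul_one, mul_zero] using this
  have hrev := rev_perm_involutive σ c
    (fun i j hij hσ => by
      have := key i j (Fin.lt_def.mpr (by omega)) hσ
      rw [if_pos hij] at this
      split_ifs at this with h
      · exact ⟨h, ((div_eq_one_iff_eq (hc j)).mp this.symm)⟩
      · exact absurd this one_ne_zero)
    (fun i j hij hσ => by
      have := key i j hij (Fin.lt_def.mpr (by omega))
      rw [if_pos hσ] at this
      by_contra h
      rw [if_neg h] at this
      exact div_ne_zero (hc i) (hc j) this.symm)
  ext i j
  rw [antiReflection_apply, hM, hM]
  by_cases hij : i = σ j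
  · subst hij
    rw [if_pos (hrev j).1.symm, if_pos rfl, (hrev j).2]
  · rw [if_neg hij, if_neg]
    intro h
    have := (hrev i.rev).1
    rw [← h, Fin.rev_rev, Fin.rev_rev] at this
    exact hij this.symm

end Reflection

/-! ### Invertibility of the order of the unipotent subgroup -/

section Card

open Matrix Polynomial

variable {n : ℕ} {K : Type*} [Field K]

/-- Cayley–Hamilton gives `(A - 1) ^ n = 0`, and in characteristic `p` one has `A ^ p ^ n - 1 = (A -
1) ^ p ^ n` with `n < p ^ n`. -/
theorem isPGroup_unipotent (n : ℕ) (K : Type*) [Field K] (p : ℕ) [Fact p.Prime] [CharP K p] :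
    IsPGroup p (unipotent n K) := by
  intro u
  refine ⟨n, Subtype.ext (Units.ext ?_)⟩
  set A : Matrix (Fin n) (Fin n) K := (u : GL (Fin n) K).val with hA
  have hchar : A.charpoly = (X - C 1) ^ n := by
    rw [charpoly_of_isUpperTriangular A fun i j hij => u.2.2 i j hij]
    have (i : Fin n) : A i i = 1 := u.2.1 i
    simp [this]
  have hnil : (A - 1) ^ n = 0 := by
    have := aeval_self_charpoly A
    rw [hchar] at this
    simpa using this
  -- For `n = 0` the matrix ring is zero and does not have characteristic `p`.
  rcases isEmpty_or_nonempty (Fin n) with h | h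
  · exact Subsingleton.elim _ _
  have hpow : A ^ p ^ n - 1 = 0 := by
    have := sub_pow_char_pow_of_commute p n (Commute.one_right A)
    rw [one_pow] at this
    rw [← this]
    exact pow_eq_zero_of_le (Nat.lt_pow_self (Fact.out : p.Prime).one_lt).le hnil
  simpa [sub_eq_zero] using hpow

/-- If `p = 0` in `F`, then `(ψ x - 1) ^ p = ψ x ^ p - 1 = 0`, which makes `ψ` trivial. -/
theorem card_unipotent_ne_zero {F : Type*} [Field F] [Finite K] [Fintype (unipotent n K)]
    {ψ : AddChar K F} (hψ : ψ ≠ 1) : (Fintype.card (unipotent n K) : F) ≠ 0 := by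
  obtain ⟨p, hp⟩ := CharP.exists K
  have hpp : p.Prime := (CharP.char_is_prime_or_zero K p).resolve_right
    (CharP.char_ne_zero_of_finite K p)
  have : Fact p.Prime := ⟨hpp⟩
  obtain ⟨m, hm⟩ := IsPGroup.iff_card.mp (isPGroup_unipotent n K p)
  rw [← Nat.card_eq_fintype_card, hm, Nat.cast_pow]
  refine pow_ne_zero _ fun h0 => hψ (DFunLike.ext _ _ fun x => ?_)
  have : CharP F p := (CharP.charP_iff_prime_eq_zero hpp).mpr h0
  have h1 : ψ x ^ p = 1 := by
    rw [← AddChar.map_nsmul_eq_pow, nsmul_eq_mul, CharP.cast_eq_zero, zero_mul,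
      AddChar.map_zero_eq_one]
  rw [AddChar.one_apply, ← sub_eq_zero]
  refine eq_zero_of_pow_eq_zero (n := p) ?_
  rw [sub_pow_char, h1, one_pow, sub_self]

end Card

end MultFree

theorem mainTheorem6 {k : Type*} [Field k] [Finite k]
    {F : Type*} [Field F] [Algebra k F] [IsAlgClosure k F]
    {K : Type*} [Field K] [Finite K] (n : ℕ) (ψ : AddChar K F) (hψ : ψ ≠ 1) :
    MultFree.IsMultiplicityFreeTriple.{w} (MultFree.unipotent n K)
        (MultFree.characterRep (MultFree.genericCharacter ψ)) ∧
      MultFree.IsTwistedGelfandPair.{w} (MultFree.unipotent n K)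
        (MultFree.genericCharacter ψ) := by
  have := Fintype.ofFinite (MultFree.unipotent n K)
  have : IsAlgClosed F := IsAlgClosure.isAlgClosed k
  have hcard := MultFree.card_unipotent_ne_zero (n := n) hψ
  have hpair : MultFree.IsTwistedGelfandPair.{w} (MultFree.unipotent n K)
      (MultFree.genericCharacter ψ) := by
    refine MultFree.isTwistedGelfandPair_of_commute hcard
      (MultFree.hecke_commute (τ := MultFree.antiReflection n K)
        (MultFree.unipotentReflection n K) (fun _ => rfl) (fun u => ?_) (fun g => ?_) hcard)
    · exact congrArg ψ (MultFree.superdiagonalSum_antiReflection _)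
    · obtain ⟨M, u, u', σ, c, hg, hc, hM⟩ :=
        MultFree.exists_eq_unipotent_mul_monomial_mul_unipotent g
      exact ⟨M, u, u', hg, MultFree.antiReflection_eq_or_exists_of_monomial hψ M σ c hc hM⟩
  exact ⟨MultFree.isMultiplicityFreeTriple_of_isTwistedGelfandPair hcard hpair, hpair⟩
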